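/- Let $M$ be a finite-dimensional smooth (Hausdorff, boundaryless) manifold with a Poisson bivector field $P$, i.e. a smooth bivector field whose bracket $\{f,g\}=P(\mathrm{d}f,\mathrm{d}g)$ on $C^\infty(M)$ satisfies the Jacobi identity. For $f\in C^\infty(M)$ let $X_f=i_{\mathrm{d}f}P$ be its Hamiltonian vector field, so that $X_f(g)=\{f,g\}$. Let $H\in C^\infty(M)$ be such that $X_H$ has periodic flow: $X_H$ is complete and there is a function $T\in C^\infty(M)$, $T>0$, with $$\mathrm{Fl}^{t+T(p)}_{X_H}(p)=\mathrm{Fl}^{t}_{X_H}(p)\qquad\text{for all } p\in M,\ t\in\mathbb{R}.$$ Let $\omega=2\pi/T$ be the frequency function, and let $\Upsilon=\frac1\omega X_H$ be the generator of the associated action of $\mathbb{S}^1=\mathbb{R}/2\pi\mathbb{Z}$. For $f\in C^\infty(M)$ define the average $$\langle f\rangle(p)=\frac1{2\pi}\int_0^{2\pi} f\big(\mathrm{Fl}^t_{\Upsilon}(p)\big)\,\mathrm{d}t .$$ Let $f,g\in C^\infty(M)$, where $g$ is $\mathbb{S}^1$-invariant, i.e. $\mathcal{L}_\Upsilon g=0$.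 Then: (a) $X_H\wedge X_\omega=0$ on $M$; (b) $\{H,g\}=0$; (c) $\langle f\rangle$ is smooth and $\langle\{f,g\}\rangle=\{\langle f\rangle,g\}$. -/

import Mathlib

open scoped Manifold ContDiff Topology Bundle

noncomputable section PoissonDefs

variable {E : Type*} [NormedAddCommGroup E] [NormedSpace ℝ E]
  {H : Type*} [TopologicalSpace H] (I : ModelWithCorners ℝ E H)
  {M : Type*} [TopologicalSpace M] [ChartedSpace H M]

/-- The bracket `{f, g} = P(df, dg)` determined by a field of contractions `α ↦ i_α P`, where
`P(α, β) = β (i_α P)`. -/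
def bivectorBracket
    (sharp : ∀ p : M, (TangentSpace I p →L[ℝ] ℝ) →L[ℝ] TangentSpace I p) (f g : M → ℝ) : M → ℝ :=
  fun p ↦ mvfderiv I g p (sharp p (mvfderiv I f p))

variable (M) in
/-- A Poisson structure on a (finite-dimensional, smooth) manifold `M`: a smooth bivector field `P`
whose bracket `{f, g} = P(df, dg)` satisfies the Jacobi identity on smooth functions. The bivector
at `p` is recorded by its contraction map `sharp p : T*_pM → T_pM`, `α ↦ i_α P`, so that
`P(α, β) = β (sharp p α)`. -/
structure PoissonStructure [IsManifold I ∞ M] where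
  /-- The contraction `α ↦ i_α P` of the bivector with covectors. -/
  sharp : ∀ p : M, (TangentSpace I p →L[ℝ] ℝ) →L[ℝ] TangentSpace I p
  /-- `P` is skew-symmetric: `P(α, β) = - P(β, α)`. -/
  skew : ∀ (p : M) (α β : TangentSpace I p →L[ℝ] ℝ), β (sharp p α) = - α (sharp p β)
  /-- `P` is a smooth section of the bundle `Hom(T*M, TM)`. -/
  smooth : ContMDiff I (I.prod 𝓘(ℝ, (E →L[ℝ] ℝ) →L[ℝ] E)) ∞
    (fun p ↦ Bundle.TotalSpace.mk' ((E →L[ℝ] ℝ) →L[ℝ] E)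
      (E := fun p : M ↦ ((TangentSpace I p →L[ℝ] Bundle.Trivial M ℝ p) →L[ℝ] TangentSpace I p))
      p (sharp p))
  /-- The Jacobi identity. -/
  jacobi : ∀ f g h : M → ℝ, ContMDiff I 𝓘(ℝ) ∞ f → ContMDiff I 𝓘(ℝ) ∞ g →
    ContMDiff I 𝓘(ℝ) ∞ h → ∀ p : M,
      bivectorBracket I sharp f (bivectorBracket I sharp g h) p
        + bivectorBracket I sharp g (bivectorBracket I sharp h f) p
        + bivectorBracket I sharp h (bivectorBracket I sharp f g) p = 0

variable {I} in
/-- The Poisson bracket `{f, g} = P(df, dg)`. -/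
def PoissonStructure.bracket [IsManifold I ∞ M] (P : PoissonStructure I M) (f g : M → ℝ) : M → ℝ :=
  bivectorBracket I P.sharp f g

variable {I} in
/-- The Hamiltonian vector field `X_f = i_{df} P`; thus `X_f(g) = {f, g}`. -/
def PoissonStructure.hamiltonianField [IsManifold I ∞ M] (P : PoissonStructure I M) (f : M → ℝ) :
    ∀ p : M, TangentSpace I p :=
  fun p ↦ P.sharp p (mvfderiv I f p)

/-- `X` is complete: through every point passes an integral curve defined on all of `ℝ`. -/
def IsCompleteField (X : ∀ p : M, TangentSpace I p) : Prop :=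
  ∀ p : M, ∃ γ : ℝ → M, γ 0 = p ∧ IsMIntegralCurve γ X

open scoped Classical in
/-- The flow `Fl^t_X(p)` of a complete vector field `X`: the value at time `t` of the integral
curve of `X` starting at `p`. (For a smooth field on a Hausdorff manifold without boundary this
curve is unique. If there is no such curve the value is the junk value `p`.) -/
def fieldFlow (X : ∀ p : M, TangentSpace I p) (t : ℝ) (p : M) : M :=
  if h : ∃ γ : ℝ → M, γ 0 = p ∧ IsMIntegralCurve γ X then h.choose t else p

/-- The vector field `X` is complete and its flow is periodic with (smooth, positive) period
function `T`: `Fl^{t + T(p)}_X(p) = Fl^t_X(p)`. -/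
structure HasPeriodicFlow (X : ∀ p : M, TangentSpace I p) (T : M → ℝ) : Prop where
  smooth : ContMDiff I 𝓘(ℝ) ∞ T
  pos : ∀ p, 0 < T p
  complete : IsCompleteField I X
  periodic : ∀ (p : M) (t : ℝ), fieldFlow I X (t + T p) p = fieldFlow I X t p

/-- The frequency function `ω = 2π / T` of a period function `T`. -/
def frequency (T : M → ℝ) : M → ℝ := fun p ↦ 2 * Real.pi / T p

/-- The generator `Υ = (1/w) X` of the circle action determined by a vector field `X` with
periodic flow of frequency `w`. -/
def circleGenerator (X : ∀ p : M, TangentSpace I p) (w : M → ℝ) : ∀ p : M, TangentSpace I p :=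
  fun p ↦ (w p)⁻¹ • X p

/-- `g` is invariant under the field `Y`: its Lie derivative `L_Y g = dg(Y)` vanishes. -/
def IsInvariantAlong (Y : ∀ p : M, TangentSpace I p) (g : M → ℝ) : Prop :=
  ∀ p : M, mvfderiv I g p (Y p) = 0

/-- The average `⟨f⟩ = (1/2π) ∫₀^{2π} (Fl^t_Y)^* f dt` of a function along the flow of `Y`. -/
def flowAverage (Y : ∀ p : M, TangentSpace I p) (f : M → ℝ) : M → ℝ :=
  fun p ↦ (2 * Real.pi)⁻¹ * ∫ t in (0 : ℝ)..(2 * Real.pi), f (fieldFlow I Y t p)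

/-- The wedge product `v ∧ w` of two tangent vectors, in `⋀² T_pM`. -/
def wedgeVec {p : M} (v w : TangentSpace I p) : ⋀[ℝ]^2 (TangentSpace I p) :=
  exteriorPower.ιMulti ℝ 2 ![v, w]

end PoissonDefs

/-!
# Periodic Hamiltonian flows and averaging

The flow `ψ_t` of a complete smooth field is smooth (`IsCompleteField.contMDiff_fieldFlow`). Locally
this comes from the implicit function theorem, applied to the integral equation
`y = x + τ ∫₀ v ∘ y` in a space of continuous curves. Rescaling the time puts `τ` into the equation
as a parameter, and at `τ = 0` the derivative in `y` is the identity. The group law extends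
smoothness to all times.

The flow of `X_h` preserves the bracket (`PoissonStructure.bracket_comp_hamiltonianFlow`): the
derivative of `{a ∘ ψ_t, b ∘ ψ_t} ∘ ψ_{-t}` is an expression that vanishes by the Jacobi identity.

Differentiating `a (ψ_{T(q)} q) = a q` at `q = p` gives `da = d(a ∘ ψ_{T(p)}) + {h, a} dT`.
Since `ψ_{T(p)}` fixes `p` and preserves the bracket, inserting this into `{a, b}` yields
`{h, a} {T, b} = {h, b} {T, a}` (`PoissonStructure.bracket_mul_bracket_period`), that is,
`X_h ∧ X_T = 0`, and `X_ω` is a multiple of `X_T`. The same identity gives `{h, T}² = 0`, so `T` is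
constant along the flow, and the circle action is `p ↦ ψ_{t T(p) / 2π}(p)`.

If `{h, g} = 0`, the identity becomes `{h, a} {T, g} = 0`. Hence the dependence of the time
`t T(p) / 2π` on `p` does not contribute to `{·, g}`, and `{f ∘ φ_t, g} = {f, g} ∘ φ_t` for the
circle action `φ_t` (`PoissonStructure.bracket_comp_circleFlow`). Integrating over `t`, with
differentiation under the integral sign, gives the statement on averages.
-/

/-! ### Local flows with smooth dependence on the initial point -/

universe u

section Superposition

-- The normed structure on `C(K, E →L[ℝ] F)` is found only after a long instance search.
set_option synthInstance.maxHeartbeats 200000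

variable {K E F : Type*} [TopologicalSpace K] [CompactSpace K]
  [NormedAddCommGroup E] [NormedSpace ℝ E] [NormedAddCommGroup F] [NormedSpace ℝ F]

variable (K E F) in
/-- The pointwise application `(A, w) ↦ (t ↦ A t (w t))` of a continuous family of operators, as a
continuous bilinear map for the sup norms. -/
noncomputable def ContinuousMap.clmApply :
    C(K, E →L[ℝ] F) →L[ℝ] C(K, E) →L[ℝ] C(K, F) :=
  LinearMap.mkContinuous₂
    (LinearMap.mk₂ ℝ (fun (A : C(K, E →L[ℝ] F)) (w : C(K, E)) ↦
        (⟨fun t ↦ A t (w t), by fun_prop⟩ : C(K, F)))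
      (fun _ _ _ ↦ by ext; simp) (fun _ _ _ ↦ by ext; simp) (fun _ _ _ ↦ by ext; simp)
      (fun _ _ _ ↦ by ext; simp))
    1 fun A w ↦ by
      rw [one_mul, ContinuousMap.norm_le _ (by positivity)]
      intro t
      exact (A t).le_of_opNorm_le_of_le (A.norm_coe_le_norm t) (w.norm_coe_le_norm t)

@[simp]
theorem ContinuousMap.clmApply_apply (A : C(K, E →L[ℝ] F)) (w : C(K, E)) (t : K) :
    ContinuousMap.clmApply K E F A w t = A t (w t) := rfl

/-- The superposition operator `y ↦ v ∘ y` of a `C¹` map is differentiable for the sup norm, with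
derivative `w ↦ (t ↦ Dv (y t) (w t))`. -/
theorem ContinuousMap.hasFDerivAt_comp_left (v : C(E, F)) (v' : C(E, E →L[ℝ] F))
    (hv : ∀ x, HasFDerivAt v (v' x) x) (y : C(K, E)) :
    HasFDerivAt (fun y : C(K, E) ↦ v.comp y)
      (ContinuousMap.clmApply K E F (v'.comp y)) y := by
  rw [hasFDerivAt_iff_isLittleO_nhds_zero, Asymptotics.isLittleO_iff]
  intro ε hε
  have hc : ContinuousAt (fun z : C(K, E) ↦ v'.comp z) y :=
    (ContinuousMap.continuous_postcomp v').continuousAt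
  obtain ⟨δ, hδ, hδε⟩ := (Metric.continuousAt_iff (α := C(K, E)) (β := C(K, E →L[ℝ] F))).1 hc ε hε
  filter_upwards [Metric.ball_mem_nhds (0 : C(K, E)) hδ] with w hw
  rw [mem_ball_zero_iff] at hw
  rw [ContinuousMap.norm_le _ (by positivity)]
  intro t
  -- the mean value inequality along the segment from `y t` to `y t + w t`
  have hseg : ∀ z ∈ segment ℝ (y t) (y t + w t), ‖v' z - v' (y t)‖ ≤ ε := by
    rintro z hz
    rw [segment_eq_image'] at hz
    obtain ⟨θ, hθ, rfl⟩ := hz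
    have h1 : dist (y + θ • w) y < δ := by
      rw [dist_eq_norm, add_sub_cancel_left, norm_smul, Real.norm_of_nonneg hθ.1]
      nlinarith [norm_nonneg w, hθ.2]
    have h2 := (ContinuousMap.dist_apply_le_dist t).trans (hδε h1).le
    simpa [dist_eq_norm] using h2
  have hconv := convex_segment (𝕜 := ℝ) (y t) (y t + w t)
  have hmv := hconv.norm_image_sub_le_of_norm_hasFDerivWithin_le' (φ := v' (y t))
    (fun z _ ↦ (hv z).hasFDerivWithinAt) hseg
    (left_mem_segment ℝ _ _) (right_mem_segment ℝ _ _)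
  simp only [add_sub_cancel_left] at hmv
  calc _ ≤ ε * ‖w t‖ := by simpa using hmv
    _ ≤ ε * ‖w‖ := by gcongr; exact w.norm_coe_le_norm t

/-- The superposition operator `y ↦ v ∘ y` of a `Cⁿ` map is `Cⁿ` for the sup norm. -/
theorem ContinuousMap.contDiff_comp_left {K : Type*} [TopologicalSpace K] [CompactSpace K]
    {E F : Type u} [NormedAddCommGroup E] [NormedSpace ℝ E] [NormedAddCommGroup F]
    [NormedSpace ℝ F] (n : ℕ) (v : C(E, F)) (hv : ContDiff ℝ n v) :
    ContDiff ℝ n (fun y : C(K, E) ↦ v.comp y) := by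
  induction n generalizing F with
  | zero => exact contDiff_zero.2 (ContinuousMap.continuous_postcomp v)
  | succ n ih =>
    push_cast at hv ⊢
    obtain ⟨hd, -, hv'⟩ := contDiff_succ_iff_fderiv.1 hv
    let v' : C(E, E →L[ℝ] F) := ⟨fderiv ℝ v, hv'.continuous⟩
    have h := fun y : C(K, E) ↦
      ContinuousMap.hasFDerivAt_comp_left v v' (fun x ↦ (hd x).hasFDerivAt) y
    refine contDiff_succ_iff_fderiv.2 ⟨fun y ↦ (h y).differentiableAt, by simp, ?_⟩
    rw [funext fun y ↦ (h y).fderiv]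
    exact (ContinuousMap.clmApply K E F).contDiff.comp (ih v' hv')

end Superposition

section LocalFlow

variable {E : Type u} [NormedAddCommGroup E] [NormedSpace ℝ E]

theorem ContinuousMap.continuous_comp_projIcc {E : Type*} [NormedAddCommGroup E]
    (y : C(Set.Icc (-2 : ℝ) 2, E)) :
    Continuous fun s : ℝ ↦ y (Set.projIcc (-2) 2 (by norm_num) s) :=
  y.continuous.comp continuous_projIcc

variable (E) in
/-- The primitive `y ↦ (t ↦ ∫₀ᵗ y)` on `C([-2, 2], E)`. The interval contains `[0, 1]` in its
interior, so that no one-sided derivatives occur at the times `0` and `1`. -/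
noncomputable def primitiveCLM : C(Set.Icc (-2 : ℝ) 2, E) →L[ℝ] C(Set.Icc (-2 : ℝ) 2, E) :=
  LinearMap.mkContinuous
    { toFun := fun y ↦ ⟨fun t ↦ ∫ s in (0 : ℝ)..t, y (Set.projIcc (-2) 2 (by norm_num) s), by
        exact (intervalIntegral.continuous_primitive
          (fun a b ↦ (y.continuous_comp_projIcc).intervalIntegrable a b) 0).comp
          continuous_subtype_val⟩
      map_add' := fun y z ↦ by
        ext t
        exact intervalIntegral.integral_add ((y.continuous_comp_projIcc).intervalIntegrable _ _)
          ((z.continuous_comp_projIcc).intervalIntegrable _ _)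
      map_smul' := fun c y ↦ by
        ext t
        exact intervalIntegral.integral_smul c _ }
    2 fun y ↦ by
      rw [ContinuousMap.norm_le _ (by positivity)]
      intro t
      refine (intervalIntegral.norm_integral_le_of_norm_le_const
        (C := ‖y‖) fun s _ ↦ y.norm_coe_le_norm _).trans ?_
      have : |(t : ℝ) - 0| ≤ 2 := by rw [sub_zero, abs_le]; exact t.2
      nlinarith [norm_nonneg y]

theorem primitiveCLM_apply (y : C(Set.Icc (-2 : ℝ) 2, E)) (t : Set.Icc (-2 : ℝ) 2) :
    primitiveCLM E y t = ∫ s in (0 : ℝ)..t, y (Set.projIcc (-2) 2 (by norm_num) s) := rfl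

variable [CompleteSpace E]

/-- Smooth dependence on initial conditions, in rescaled time: for a `Cⁿ` field `v` there is a
family `Y (τ, x)` of curves on `[-2, 2]`, `Cⁿ` in `(τ, x)` near `(0, x₀)`, with
`Y (τ, x) 0 = x` and velocity `τ • v`. It is obtained from the implicit function theorem in
`C([-2, 2], E)`: at `τ = 0` the integral equation `y - x - τ ∫₀ v ∘ y = 0` has derivative `id` in
`y`. -/
theorem exists_contDiffAt_family_of_curves {n : ℕ} (hn : n ≠ 0) {v : E → E} (hv : ContDiff ℝ n v)
    (x₀ : E) :
    ∃ Y : ℝ × E → C(Set.Icc (-2 : ℝ) 2, E), ContDiffAt ℝ n Y (0, x₀) ∧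
      Y (0, x₀) = ContinuousMap.const _ x₀ ∧
      ∀ᶠ z : ℝ × E in 𝓝 (0, x₀), ∀ t : Set.Icc (-2 : ℝ) 2, Y z t = z.2 + z.1 •
        ∫ s in (0 : ℝ)..t, v (Y z (Set.projIcc (-2) 2 (by norm_num) s)) := by
  let cE : E →L[ℝ] C(Set.Icc (-2 : ℝ) 2, E) := ContinuousLinearMap.const ℝ _
  let w : C(E, E) := ⟨v, hv.continuous⟩
  let Φ : (ℝ × E) × C(Set.Icc (-2 : ℝ) 2, E) → C(Set.Icc (-2 : ℝ) 2, E) := fun z ↦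
    z.2 - cE z.1.2 - z.1.1 • primitiveCLM E (w.comp z.2)
  have hΦ : ContDiff ℝ n Φ := by
    have h1 : ContDiff ℝ n fun z : (ℝ × E) × C(Set.Icc (-2 : ℝ) 2, E) ↦ w.comp z.2 :=
      (ContinuousMap.contDiff_comp_left n w hv).comp contDiff_snd
    have h2 := (primitiveCLM E).contDiff.comp h1
    have h3 : ContDiff ℝ n fun z : (ℝ × E) × C(Set.Icc (-2 : ℝ) 2, E) ↦ cE z.1.2 :=
      cE.contDiff.comp (by fun_prop)
    exact (contDiff_snd.sub h3).sub ((contDiff_fst.comp contDiff_fst).smul h2)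
  set u : (ℝ × E) × C(Set.Icc (-2 : ℝ) 2, E) := ((0, x₀), cE x₀) with hu
  have hn' : ((n : ℕ∞) : ℕ∞ω) ≠ 0 := by exact_mod_cast hn
  -- at `τ = 0` the integral term vanishes identically in `y`
  have hinr : fderiv ℝ Φ u ∘L .inr ℝ (ℝ × E) C(Set.Icc (-2 : ℝ) 2, E) =
      ContinuousLinearMap.id ℝ _ := by
    have h1 : HasFDerivAt Φ (fderiv ℝ Φ u) u := (hΦ.differentiable hn' u).hasFDerivAt
    have h2 : HasFDerivAt (fun y ↦ Φ ((0, x₀), y))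
        (fderiv ℝ Φ u ∘L .inr ℝ (ℝ × E) C(Set.Icc (-2 : ℝ) 2, E)) (cE x₀) :=
      HasFDerivAt.comp (cE x₀) (by exact h1) (hasFDerivAt_prodMk_right _ _)
    refine h2.unique ?_
    have : (fun y ↦ Φ ((0, x₀), y)) = fun y ↦ y - cE x₀ := by
      ext y; simp [Φ]
    rw [this]
    exact (hasFDerivAt_id _).sub_const _
  have hinv : (fderiv ℝ Φ u ∘L .inr ℝ (ℝ × E) C(Set.Icc (-2 : ℝ) 2, E)).IsInvertible := by
    rw [hinr]; exact ⟨ContinuousLinearEquiv.refl ℝ _, rfl⟩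
  have hΦu : Φ u = 0 := by simp [Φ, hu]
  refine ⟨hΦ.contDiffAt.implicitFunction hn' hinv,
    hΦ.contDiffAt.contDiffAt_implicitFunction hn' hinv,
    hΦ.contDiffAt.implicitFunction_apply_self hn' hinv, ?_⟩
  filter_upwards [hΦ.contDiffAt.eventually_apply_implicitFunction hn' hinv] with z hz t
  rw [hΦu] at hz
  have := DFunLike.congr_fun hz t
  simp only [Φ, ContinuousMap.sub_apply, ContinuousMap.smul_apply, primitiveCLM_apply,
    ContinuousMap.zero_apply] at this
  rw [sub_sub, sub_eq_zero] at this
  exact this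

/-- A `Cⁿ` field has a local flow which is `Cⁿ` jointly in time and initial point. For `(τ, x)`
near `(0, x₀)` the value `α (τ, x)` is the time-one value of a curve with velocity `τ • v`
starting at `x`, and these curves stay in a prescribed neighbourhood of `x₀`. -/
theorem exists_contDiffAt_localFlow {n : ℕ} (hn : n ≠ 0) {v : E → E} (hv : ContDiff ℝ n v)
    (x₀ : E) {U : Set E} (hU : U ∈ 𝓝 x₀) :
    ∃ α : ℝ × E → E, ContDiffAt ℝ n α (0, x₀) ∧ α (0, x₀) = x₀ ∧
      ∀ᶠ z : ℝ × E in 𝓝 (0, x₀), ∃ y : ℝ → E, y 0 = z.2 ∧ y 1 = α z ∧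
        ∀ s ∈ Set.Ioo (-2 : ℝ) 2, y s ∈ U ∧ HasDerivAt y (z.1 • v (y s)) s := by
  obtain ⟨Y, hY, hY0, hYeq⟩ := exists_contDiffAt_family_of_curves hn hv x₀
  obtain ⟨r, hr, hrU⟩ := Metric.mem_nhds_iff.1 hU
  let one : Set.Icc (-2 : ℝ) 2 := ⟨1, by norm_num, by norm_num⟩
  refine ⟨fun z ↦ Y z one, ?_, by simp [hY0], ?_⟩
  · exact (ContinuousMap.evalCLM ℝ one).contDiff.contDiffAt.comp (0, x₀) hY
  filter_upwards [hYeq, hY.continuousAt (Metric.ball_mem_nhds _ hr)] with z hz hzr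
  rw [Set.mem_preimage, Metric.mem_ball, hY0] at hzr
  have hc : Continuous fun s : ℝ ↦ v (Y z (Set.projIcc (-2) 2 (by norm_num) s)) :=
    hv.continuous.comp (Y z).continuous_comp_projIcc
  -- the right hand side of the integral equation extends the curve to all times
  let y : ℝ → E := fun t ↦
    z.2 + z.1 • ∫ s in (0 : ℝ)..t, v (Y z (Set.projIcc (-2) 2 (by norm_num) s))
  have hy : ∀ s ∈ Set.Icc (-2 : ℝ) 2, y s = Y z (Set.projIcc (-2) 2 (by norm_num) s) := by
    intro s hs
    rw [Set.projIcc_of_mem _ hs, hz]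
  refine ⟨y, by simp [y], ?_, fun s hs ↦ ⟨hrU ?_, ?_⟩⟩
  · rw [hy 1 one.2, Set.projIcc_of_mem _ one.2]
  · rw [hy s (Set.Ioo_subset_Icc_self hs)]
    exact (ContinuousMap.dist_apply_le_dist (f := Y z) (g := ContinuousMap.const _ x₀) _).trans_lt
      hzr
  · have h1 := ((hc.integral_hasStrictDerivAt 0 s).hasDerivAt.const_smul z.1).const_add z.2
    rw [← hy s (Set.Ioo_subset_Icc_self hs)] at h1
    exact h1

end LocalFlow

/-- A germ of a `Cⁿ` map extends to the whole space, after multiplication by a bump function. -/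
theorem ContDiffAt.exists_contDiff_eventuallyEq {E F : Type*} [NormedAddCommGroup E]
    [NormedSpace ℝ E] [FiniteDimensional ℝ E] [NormedAddCommGroup F] [NormedSpace ℝ F] {n : ℕ}
    {w : E → F} {x : E} (hw : ContDiffAt ℝ n w x) :
    ∃ v : E → F, ContDiff ℝ n v ∧ v =ᶠ[𝓝 x] w := by
  obtain ⟨r, hr, hrw⟩ := Metric.eventually_nhds_iff_ball.1 (hw.eventually (by simp))
  let χ : ContDiffBump x := ⟨r / 4, r / 2, by positivity, by linarith⟩
  refine ⟨fun e ↦ χ e • w e, contDiff_iff_contDiffAt.2 fun e ↦ ?_, ?_⟩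
  · by_cases he : e ∈ Metric.ball x r
    · exact χ.contDiffAt.smul (hrw e he)
    · have he' : e ∉ tsupport χ := by
        rw [χ.tsupport_eq]
        intro h
        have h : Dist.dist e x ≤ r / 2 := h
        rw [Metric.mem_ball] at he
        linarith
      refine (contDiffAt_const (c := (0 : F))).congr_of_eventuallyEq ?_
      filter_upwards [notMem_tsupport_iff_eventuallyEq.1 he'] with z hz
      simp [hz]
  · filter_upwards [χ.eventuallyEq_one] with e he
    simp [he]

/-! ### Smoothness of global flows -/

section Flow

variable {E : Type*} [NormedAddCommGroup E] [NormedSpace ℝ E]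
  {H : Type*} [TopologicalSpace H] {I : ModelWithCorners ℝ E H}
  {M : Type*} [TopologicalSpace M] [ChartedSpace H M]
  {X : ∀ p : M, TangentSpace I p}

theorem IsCompleteField.fieldFlow_zero (hc : IsCompleteField I X) (p : M) :
    fieldFlow I X 0 p = p := by
  rw [fieldFlow, dif_pos (hc p)]
  exact (hc p).choose_spec.1

theorem IsCompleteField.isMIntegralCurve_fieldFlow (hc : IsCompleteField I X) (p : M) :
    IsMIntegralCurve (fun t ↦ fieldFlow I X t p) X := by
  have : (fun t ↦ fieldFlow I X t p) = (hc p).choose := by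
    ext t
    rw [fieldFlow, dif_pos (hc p)]
  rw [this]
  exact (hc p).choose_spec.2

variable [IsManifold I ∞ M] [T2Space M] [I.Boundaryless]

/-- Integral curves are unique, so each of them is given by the flow. -/
theorem fieldFlow_eq_of_isMIntegralCurve
    (hX : ContMDiff I I.tangent ∞ fun p ↦ (⟨p, X p⟩ : TangentBundle I M))
    {γ : ℝ → M} (hγ : IsMIntegralCurve γ X) (t : ℝ) : fieldFlow I X t (γ 0) = γ t := by
  have hex : ∃ γ' : ℝ → M, γ' 0 = γ 0 ∧ IsMIntegralCurve γ' X := ⟨γ, rfl, hγ⟩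
  rw [fieldFlow, dif_pos hex]
  exact congrFun (isMIntegralCurve_Ioo_eq_of_contMDiff_boundaryless (t₀ := 0)
    (hX.of_le (by simp)) hex.choose_spec.2 hγ hex.choose_spec.1) t

theorem IsCompleteField.fieldFlow_add
    (hX : ContMDiff I I.tangent ∞ fun p ↦ (⟨p, X p⟩ : TangentBundle I M))
    (hc : IsCompleteField I X) (s t : ℝ) (p : M) :
    fieldFlow I X (s + t) p = fieldFlow I X s (fieldFlow I X t p) := by
  have h := fieldFlow_eq_of_isMIntegralCurve hX
    ((hc.isMIntegralCurve_fieldFlow p).comp_add t) s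
  simpa using h.symm

omit [T2Space M] in
/-- A curve in the chart at `x₀` whose velocity is `c` times the field `X` read in this chart maps
to a curve in `M` with velocity `c • X`. -/
theorem hasMFDerivAt_extChartAt_symm_comp (x₀ : M) {y : ℝ → E} {c t : ℝ}
    (hyt : y t ∈ (extChartAt I x₀).target)
    (hy : HasDerivAt y (c • tangentCoordChange I ((extChartAt I x₀).symm (y t)) x₀
      ((extChartAt I x₀).symm (y t)) (X ((extChartAt I x₀).symm (y t)))) t) :
    HasMFDerivAt 𝓘(ℝ, ℝ) I ((extChartAt I x₀).symm ∘ y) t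
      ((1 : ℝ →L[ℝ] ℝ).smulRight (c • X ((extChartAt I x₀).symm (y t)))) := by
  set xₜ : M := (extChartAt I x₀).symm (y t) with hxt
  have hft1 : xₜ ∈ (extChartAt I x₀).source := (extChartAt I x₀).map_target hyt
  have hft2 := mem_extChartAt_source (I := I) xₜ
  -- the velocity is moved by the coordinate change from the chart at `x₀` to the one at `xₜ`
  have key : ∀ ξ : E, HasDerivAt y (c • tangentCoordChange I xₜ x₀ xₜ ξ) t →
      HasDerivAt ((extChartAt I xₜ ∘ (extChartAt I x₀).symm) ∘ y) (c • ξ) t := by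
    intro ξ hy
    rw [← tangentCoordChange_self (I := I) (x := xₜ) (z := xₜ) (v := ξ) hft2,
      ← tangentCoordChange_comp (x := x₀) ⟨⟨hft2, hft1⟩, hft2⟩, ← map_smul]
    apply HasFDerivAt.comp_hasDerivAt _ _ hy
    apply HasFDerivWithinAt.hasFDerivAt (s := Set.range I) _ (by simp [I.range_eq_univ])
    rw [← (extChartAt I x₀).right_inv hyt]
    exact hasFDerivWithinAt_tangentCoordChange ⟨hft1, hft2⟩
  refine ⟨(continuousAt_extChartAt_symm'' hyt).comp hy.continuousAt, ?_⟩
  have h := (key (X xₜ) hy).hasFDerivAt.hasFDerivWithinAt (s := Set.univ)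
  rw [← ContinuousLinearMap.smulRight_one_eq_toSpanSingleton] at h
  simpa only [mfld_simps] using! h

omit [T2Space M] in
/-- Near a point, a smooth vector field read in the chart at this point agrees with a `Cⁿ` field
on the whole model space. -/
theorem exists_contDiff_eventuallyEq_chart [FiniteDimensional ℝ E]
    (hX : ContMDiff I I.tangent ∞ fun p ↦ (⟨p, X p⟩ : TangentBundle I M)) (x₀ : M) (n : ℕ) :
    ∃ v : E → E, ContDiff ℝ n v ∧ ∀ᶠ e in 𝓝 (extChartAt I x₀ x₀),
      v e = tangentCoordChange I ((extChartAt I x₀).symm e) x₀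
        ((extChartAt I x₀).symm e) (X ((extChartAt I x₀).symm e)) := by
  obtain ⟨-, hv⟩ := contMDiffAt_iff.1 (hX.contMDiffAt (x := x₀))
  have hv := ((hv.contDiffAt (by simp [I.range_eq_univ])).snd).of_le (m := n)
    (by exact_mod_cast le_top)
  exact hv.exists_contDiff_eventuallyEq

/-- The flow of a complete smooth field is `Cⁿ` near time zero. -/
theorem IsCompleteField.contMDiffAt_fieldFlow_zero [FiniteDimensional ℝ E]
    (hX : ContMDiff I I.tangent ∞ fun p ↦ (⟨p, X p⟩ : TangentBundle I M))
    (hc : IsCompleteField I X) {n : ℕ} (hn : n ≠ 0) (x₀ : M) :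
    ContMDiffAt (𝓘(ℝ, ℝ).prod I) I n (fun z : ℝ × M ↦ fieldFlow I X z.1 z.2) (0, x₀) := by
  have := FiniteDimensional.complete ℝ E
  obtain ⟨v, hv, hvX⟩ := exists_contDiff_eventuallyEq_chart hX x₀ n
  obtain ⟨α, hα, hα0, hαy⟩ := exists_contDiffAt_localFlow hn hv (extChartAt I x₀ x₀)
    (hvX.and (extChartAt_target_mem_nhds x₀))
  have hchart : ContMDiffAt (𝓘(ℝ, ℝ).prod I) 𝓘(ℝ, ℝ × E) n
      (fun z : ℝ × M ↦ (z.1, extChartAt I x₀ z.2)) (0, x₀) :=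
    contMDiffAt_fst.prodMk_space
      ((contMDiffAt_extChartAt (x := x₀)).comp (0, x₀) contMDiffAt_snd)
  have hsymm : ContMDiffAt 𝓘(ℝ, E) I n (extChartAt I x₀).symm (extChartAt I x₀ x₀) :=
    (contMDiffOn_extChartAt_symm x₀).contMDiffAt (extChartAt_target_mem_nhds x₀)
  have hcomp : ContMDiffAt (𝓘(ℝ, ℝ).prod I) I n
      (fun z : ℝ × M ↦ (extChartAt I x₀).symm (α (z.1, extChartAt I x₀ z.2))) (0, x₀) :=
    ContMDiffAt.comp_of_eq (x := ((0, x₀) : ℝ × M)) hsymm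
      (hα.contMDiffAt.comp (0, x₀) hchart) hα0
  -- by uniqueness the flow is the local flow of the chart, whose curves run in rescaled time
  refine hcomp.congr_of_eventuallyEq ?_
  have hsrc : ∀ᶠ z : ℝ × M in 𝓝 (0, x₀), z.2 ∈ (extChartAt I x₀).source :=
    continuousAt_snd.eventually (extChartAt_source_mem_nhds x₀)
  filter_upwards [hchart.continuousAt.eventually hαy, hsrc] with z ⟨y, hy0, hy1, hy⟩ hz
  have h1 : IsMIntegralCurveOn ((extChartAt I x₀).symm ∘ y) (z.1 • X) (Set.Ioo (-2) 2) := by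
    intro s hs
    obtain ⟨⟨hvs, hst⟩, hys⟩ := hy s hs
    rw [hvs] at hys
    exact (hasMFDerivAt_extChartAt_symm_comp x₀ hst hys).hasMFDerivWithinAt
  have h2 : IsMIntegralCurveOn (fun s ↦ fieldFlow I X (s * z.1) z.2) (z.1 • X)
      (Set.Ioo (-2) 2) :=
    ((hc.isMIntegralCurve_fieldFlow z.2).comp_mul z.1).isMIntegralCurveOn _
  have hX' : ContMDiff I I.tangent 1 fun p ↦ (⟨p, (z.1 • X) p⟩ : TangentBundle I M) :=
    ContMDiff.smul_section contMDiff_const (hX.of_le (by simp))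
  have h3 := isMIntegralCurveOn_Ioo_eqOn_of_contMDiff_boundaryless (t₀ := 0) (by norm_num)
    hX' h1 h2 (by rw [Function.comp_apply, hy0, (extChartAt I x₀).left_inv hz, zero_mul,
      hc.fieldFlow_zero])
  have h4 := h3 (show (1 : ℝ) ∈ Set.Ioo (-2) 2 by norm_num)
  simpa [hy1] using h4.symm

/-- The flow of a complete smooth field is smooth jointly in time and initial point. For finite
`n` the times at which it is `Cⁿ` along a given orbit form a clopen set, by the group law. -/
theorem IsCompleteField.contMDiff_fieldFlow [FiniteDimensional ℝ E]
    (hX : ContMDiff I I.tangent ∞ fun p ↦ (⟨p, X p⟩ : TangentBundle I M))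
    (hc : IsCompleteField I X) :
    ContMDiff (𝓘(ℝ, ℝ).prod I) I ∞ fun z : ℝ × M ↦ fieldFlow I X z.1 z.2 := by
  suffices H : ∀ n : ℕ, n ≠ 0 →
      ContMDiff (𝓘(ℝ, ℝ).prod I) I n fun z : ℝ × M ↦ fieldFlow I X z.1 z.2 from
    contMDiff_infty.2 fun n ↦ (H (n + 1) (by simp)).of_le (by simp)
  rintro n hn ⟨t₀, p⟩
  set Φ : ℝ × M → M := fun z ↦ fieldFlow I X z.1 z.2 with hΦ
  set S : Set ℝ := {t | ContMDiffAt (𝓘(ℝ, ℝ).prod I) I n Φ (t, p)} with hS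
  -- near `(t', p)` the flow is the time-`t` map followed by the flow for times close to `t' - t`
  have step : ∀ t t', t ∈ S →
      ContMDiffAt (𝓘(ℝ, ℝ).prod I) I n Φ (t' - t, fieldFlow I X t p) → t' ∈ S := by
    intro t t' ht h
    have hflow : ContMDiffAt (𝓘(ℝ, ℝ).prod I) I n (fun z : ℝ × M ↦ fieldFlow I X t z.2) (t', p) :=
      ContMDiffAt.comp (t', p) (g := Φ) (f := fun z : ℝ × M ↦ (t, z.2)) ht
        (contMDiffAt_const.prodMk contMDiffAt_snd)
    have hpair : ContMDiffAt (𝓘(ℝ, ℝ).prod I) (𝓘(ℝ, ℝ).prod I) n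
        (fun z : ℝ × M ↦ (z.1 - t, fieldFlow I X t z.2)) (t', p) :=
      ContMDiffAt.prodMk (contMDiffAt_fst.sub contMDiffAt_const) hflow
    refine (ContMDiffAt.comp (t', p) (g := Φ) h hpair).congr_of_eventuallyEq (.of_forall ?_)
    intro z
    simp only [hΦ, Function.comp_apply]
    rw [← hc.fieldFlow_add hX, sub_add_cancel]
  have hloc : ∀ t, ∀ᶠ t' in 𝓝 t, (t ∈ S ↔ t' ∈ S) := by
    intro t
    have h0 := (contMDiffAt_iff_contMDiffAt_nhds (by simp)).1
      (hc.contMDiffAt_fieldFlow_zero hX hn (fieldFlow I X t p))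
    have hγ := (hc.isMIntegralCurve_fieldFlow p).continuous
    have h1 : Filter.Tendsto (fun t' ↦ (t' - t, fieldFlow I X t p)) (𝓝 t)
        (𝓝 ((0 : ℝ), fieldFlow I X t p)) := by
      have : Continuous fun t' : ℝ ↦ (t' - t, fieldFlow I X t p) := by fun_prop
      simpa using this.tendsto t
    have h2 : Filter.Tendsto (fun t' ↦ (t - t', fieldFlow I X t' p)) (𝓝 t)
        (𝓝 ((0 : ℝ), fieldFlow I X t p)) := by
      have : Continuous fun t' : ℝ ↦ (t - t', fieldFlow I X t' p) := by fun_prop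
      simpa using this.tendsto t
    filter_upwards [h1.eventually h0, h2.eventually h0] with t' h1 h2
    exact ⟨fun h ↦ step t t' h h1, fun h ↦ step t' t h h2⟩
  have hclopen : IsClopen S := by
    refine ⟨⟨isOpen_iff_mem_nhds.2 fun t ht ↦ ?_⟩, isOpen_iff_mem_nhds.2 fun t ht ↦ ?_⟩
    · filter_upwards [hloc t] with t' h
      exact fun h' ↦ ht (h.2 h')
    · filter_upwards [hloc t] with t' h
      exact h.1 ht
  have h0 : (0 : ℝ) ∈ S := hc.contMDiffAt_fieldFlow_zero hX hn p
  have : t₀ ∈ S := by rw [hclopen.eq_univ ⟨0, h0⟩]; trivial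
  exact this

end Flow

/-! ### Differentials and brackets of smooth families of functions -/

/-- The time derivative commutes with the differential in space, by symmetry of the second
derivative. -/
theorem hasDerivAt_fderiv_of_contDiffAt {E : Type*} [NormedAddCommGroup E] [NormedSpace ℝ E]
    {G : ℝ × E → ℝ} {t₀ : ℝ} {y₀ : E} (hG : ContDiffAt ℝ 2 G (t₀, y₀)) :
    HasDerivAt (fun t ↦ fderiv ℝ (fun y ↦ G (t, y)) y₀)
      (fderiv ℝ (fun y ↦ deriv (fun t ↦ G (t, y)) t₀) y₀) t₀ := by
  have hdiff : ∀ᶠ z in 𝓝 (t₀, y₀), DifferentiableAt ℝ G z :=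
    (hG.eventually (by simp)).mono fun z hz ↦ hz.differentiableAt (by simp)
  have hD : HasFDerivAt (fderiv ℝ G) (fderiv ℝ (fderiv ℝ G) (t₀, y₀)) (t₀, y₀) :=
    ((hG.fderiv_right (m := 1) le_rfl).differentiableAt (by simp)).hasFDerivAt
  have hsymm : IsSymmSndFDerivAt ℝ G (t₀, y₀) := hG.isSymmSndFDerivAt (by simp)
  have hy : (fun t ↦ fderiv ℝ (fun y ↦ G (t, y)) y₀) =ᶠ[𝓝 t₀]
      fun t ↦ fderiv ℝ G (t, y₀) ∘L .inr ℝ ℝ E := by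
    have hc : Filter.Tendsto (fun t : ℝ ↦ (t, y₀)) (𝓝 t₀) (𝓝 (t₀, y₀)) :=
      (Continuous.prodMk_left y₀).tendsto t₀
    filter_upwards [hc.eventually hdiff] with t ht
    exact (ht.hasFDerivAt.comp y₀ (hasFDerivAt_prodMk_right t y₀)).fderiv
  have ht : (fun y ↦ deriv (fun t ↦ G (t, y)) t₀) =ᶠ[𝓝 y₀]
      fun y ↦ fderiv ℝ G (t₀, y) (1, 0) := by
    have hc : Filter.Tendsto (fun y : E ↦ (t₀, y)) (𝓝 y₀) (𝓝 (t₀, y₀)) :=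
      (Continuous.prodMk_right t₀).tendsto y₀
    filter_upwards [hc.eventually hdiff] with y hy
    exact (hy.hasFDerivAt.comp_hasDerivAt t₀
      ((hasDerivAt_id t₀).prodMk (hasDerivAt_const t₀ y))).deriv
  have h1 : HasDerivAt (fun t ↦ fderiv ℝ G (t, y₀))
      (fderiv ℝ (fderiv ℝ G) (t₀, y₀) (1, 0)) t₀ :=
    hD.comp_hasDerivAt t₀ ((hasDerivAt_id t₀).prodMk (hasDerivAt_const t₀ y₀))
  have h2 : HasFDerivAt (fun y ↦ fderiv ℝ G (t₀, y))
      (fderiv ℝ (fderiv ℝ G) (t₀, y₀) ∘L .inr ℝ ℝ E) y₀ :=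
    hD.comp y₀ (hasFDerivAt_prodMk_right t₀ y₀)
  refine HasDerivAt.congr_of_eventuallyEq ?_ hy
  rw [ht.fderiv_eq]
  refine (h1.clm_comp (hasDerivAt_const t₀ (ContinuousLinearMap.inr ℝ ℝ E))).congr_deriv ?_
  ext v
  rw [(h2.clm_apply (hasFDerivAt_const ((1 : ℝ), (0 : E)) y₀)).fderiv]
  simpa using hsymm (1, 0) (0, v)

section Differentials

variable {E : Type*} [NormedAddCommGroup E] [NormedSpace ℝ E]
  {H : Type*} [TopologicalSpace H] {I : ModelWithCorners ℝ E H}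
  {M : Type*} [TopologicalSpace M] [ChartedSpace H M]  [IsManifold I ∞ M]

omit [IsManifold I ∞ M] in
theorem contMDiff_slice {F : ℝ × M → ℝ} (hF : ContMDiff (𝓘(ℝ, ℝ).prod I) 𝓘(ℝ) ∞ F) (t : ℝ) :
    ContMDiff I 𝓘(ℝ) ∞ fun p ↦ F (t, p) :=
  hF.comp (contMDiff_const.prodMk contMDiff_id)

/-- The differentials `dF_t` of a smooth family of functions form a smooth family of covector
fields. -/
theorem contMDiff_mvfderiv_family {F : ℝ × M → ℝ} (hF : ContMDiff (𝓘(ℝ, ℝ).prod I) 𝓘(ℝ) ∞ F) :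
    ContMDiff (𝓘(ℝ, ℝ).prod I) (I.prod 𝓘(ℝ, E →L[ℝ] ℝ)) ∞
      fun z : ℝ × M ↦ Bundle.TotalSpace.mk' (E →L[ℝ] ℝ)
        (E := fun p : M ↦ (TangentSpace I p →L[ℝ] Bundle.Trivial M ℝ p))
        z.2 (mvfderiv I (fun q ↦ F (z.1, q)) z.2) := by
  intro z
  rw [contMDiffAt_hom_bundle]
  refine ⟨contMDiffAt_snd, ?_⟩
  have h := ContMDiffAt.mfderiv (I := I) (J := 𝓘(ℝ, ℝ).prod I) (I' := 𝓘(ℝ)) (x₀ := z)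
    (n := ∞) (m := ∞)
    (fun (w : ℝ × M) (q : M) ↦ F (w.1, q)) Prod.snd 
    (ContMDiffAt.comp_of_eq (x := (z, z.2)) (y := z) (hF.contMDiffAt (x := z))
      ((contMDiffAt_fst.comp _ contMDiffAt_fst).prodMk contMDiffAt_snd) rfl)
      contMDiffAt_snd (by simp)
  refine h.congr_of_eventuallyEq (.of_forall fun w ↦ ?_)
  ext v
  simp [inTangentCoordinates, ContinuousLinearMap.inCoordinates, mvfderiv]
  rfl

/-- If `∂_t F = F'` at time `t₀`, then `∂_t (dF_t) = dF'` at time `t₀`, in a fixed cotangent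
space. -/
theorem hasDerivAt_mvfderiv_family [I.Boundaryless] {F : ℝ × M → ℝ}
    (hF : ContMDiff (𝓘(ℝ, ℝ).prod I) 𝓘(ℝ) ∞ F) {t₀ : ℝ} {F' : M → ℝ}
    (hF' : ContMDiff I 𝓘(ℝ) ∞ F') (hd : ∀ p, HasDerivAt (fun t ↦ F (t, p)) (F' p) t₀) (q : M) :
    HasDerivAt (fun t ↦ (mvfderiv I (fun p ↦ F (t, p)) q : E →L[ℝ] ℝ))
      (mvfderiv I F' q : E →L[ℝ] ℝ) t₀ := by
  have hsymm : ContMDiffAt 𝓘(ℝ, E) I ∞ (extChartAt I q).symm (extChartAt I q q) :=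
    (contMDiffOn_extChartAt_symm q).contMDiffAt (extChartAt_target_mem_nhds q)
  have hG : ContDiffAt ℝ 2 (fun z : ℝ × E ↦ F (z.1, (extChartAt I q).symm z.2))
      (t₀, extChartAt I q q) := by
    have h1 : ContMDiffAt 𝓘(ℝ, ℝ × E) (𝓘(ℝ, ℝ).prod I) ∞
        (fun z : ℝ × E ↦ (z.1, (extChartAt I q).symm z.2)) (t₀, extChartAt I q q) :=
      contDiffAt_fst.contMDiffAt.prodMk
        (ContMDiffAt.comp (t₀, extChartAt I q q) hsymm contDiffAt_snd.contMDiffAt)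
    exact ((hF.contMDiffAt.comp _ h1).contDiffAt).of_le ENat.LEInfty.out
  -- the differential at the centre of a chart is the derivative of the coordinate expression
  have key : ∀ a : M → ℝ, ContMDiff I 𝓘(ℝ) ∞ a →
      (mvfderiv I a q : E →L[ℝ] ℝ) = fderiv ℝ (a ∘ (extChartAt I q).symm) (extChartAt I q q) := by
    intro a ha
    rw [(ha.mdifferentiable (by simp) q).mvfderiv, I.range_eq_univ, fderivWithin_univ]
    rfl
  have h := hasDerivAt_fderiv_of_contDiffAt hG
  simp only [(hd _).deriv] at h
  rw [key F' hF']
  simp only [fun t ↦ key _ (contMDiff_slice hF t)]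
  exact h

end Differentials

section Bracket

variable {E : Type*} [NormedAddCommGroup E] [NormedSpace ℝ E]
  {H : Type*} [TopologicalSpace H] {I : ModelWithCorners ℝ E H}
  {M : Type*} [TopologicalSpace M] [ChartedSpace H M]  [IsManifold I ∞ M]
  (P : PoissonStructure I M)

namespace PoissonStructure

theorem contMDiff_hamiltonianField_family {F : ℝ × M → ℝ}
    (hF : ContMDiff (𝓘(ℝ, ℝ).prod I) 𝓘(ℝ) ∞ F) :
    ContMDiff (𝓘(ℝ, ℝ).prod I) I.tangent ∞ fun z : ℝ × M ↦
      (⟨z.2, P.hamiltonianField (fun q ↦ F (z.1, q)) z.2⟩ : TangentBundle I M) :=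
  ContMDiff.clm_bundle_apply (b := fun z : ℝ × M ↦ z.2) (P.smooth.comp contMDiff_snd)
    (contMDiff_mvfderiv_family hF)

theorem contMDiff_hamiltonianField {f : M → ℝ} (hf : ContMDiff I 𝓘(ℝ) ∞ f) :
    ContMDiff I I.tangent ∞ fun p ↦ (⟨p, P.hamiltonianField f p⟩ : TangentBundle I M) :=
  (P.contMDiff_hamiltonianField_family (F := fun z ↦ f z.2) (hf.comp contMDiff_snd)).comp
    (f := fun p : M ↦ ((0 : ℝ), p)) (contMDiff_const.prodMk contMDiff_id)

theorem contMDiff_bracket_family {F G : ℝ × M → ℝ}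
    (hF : ContMDiff (𝓘(ℝ, ℝ).prod I) 𝓘(ℝ) ∞ F) (hG : ContMDiff (𝓘(ℝ, ℝ).prod I) 𝓘(ℝ) ∞ G) :
    ContMDiff (𝓘(ℝ, ℝ).prod I) 𝓘(ℝ) ∞ fun z : ℝ × M ↦
      P.bracket (fun q ↦ F (z.1, q)) (fun q ↦ G (z.1, q)) z.2 := by
  have h := ContMDiff.clm_bundle_apply (b := fun z : ℝ × M ↦ z.2) (F₂ := ℝ)
    (E₂ := Bundle.Trivial M ℝ)
    (contMDiff_mvfderiv_family hG) (P.contMDiff_hamiltonianField_family hF)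
  intro z
  exact ((Bundle.contMDiffAt_totalSpace).1 (h z)).2

theorem contMDiff_bracket {f g : M → ℝ}
    (hf : ContMDiff I 𝓘(ℝ) ∞ f) (hg : ContMDiff I 𝓘(ℝ) ∞ g) :
    ContMDiff I 𝓘(ℝ) ∞ (P.bracket f g) :=
  (P.contMDiff_bracket_family (F := fun z ↦ f z.2) (G := fun z ↦ g z.2)
    (hf.comp contMDiff_snd) (hg.comp contMDiff_snd)).comp
    (f := fun p : M ↦ ((0 : ℝ), p)) (contMDiff_const.prodMk contMDiff_id)

theorem bracket_skew (f g : M → ℝ) (p : M) : P.bracket f g p = -P.bracket g f p :=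
  P.skew p _ _

theorem bracket_self (f : M → ℝ) (p : M) : P.bracket f f p = 0 := by
  have := P.bracket_skew f f p
  linarith

theorem bracket_eq (f g : M → ℝ) (p : M) :
    P.bracket f g p = mvfderiv I g p (P.hamiltonianField f p) := rfl

/-- The Jacobi identity, in the form that `{h, ·}` is a derivation of the bracket. -/
theorem jacobi_leibniz {f g h : M → ℝ} (hf : ContMDiff I 𝓘(ℝ) ∞ f) (hg : ContMDiff I 𝓘(ℝ) ∞ g)
    (hh : ContMDiff I 𝓘(ℝ) ∞ h) (p : M) :
    P.bracket h (P.bracket f g) p =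
      P.bracket (P.bracket h f) g p + P.bracket f (P.bracket h g) p := by
  have h1 : P.bracket h (P.bracket f g) p + P.bracket f (P.bracket g h) p
    + P.bracket g (P.bracket h f) p = 0 := P.jacobi h f g hh hf hg p
  have h2 := P.bracket_skew g (P.bracket h f) p
  have h3 : P.bracket f (P.bracket g h) p = - P.bracket f (P.bracket h g) p := by
    have : P.bracket g h = - P.bracket h g := funext fun q ↦ P.bracket_skew g h q
    rw [this, bracket_eq, bracket_eq, mvfderiv_neg]
    rfl
  linarith

/-- Leibniz rule for the time derivative, at a fixed point, of the bracket of two families of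
functions. -/
theorem hasDerivAt_bracket_family [I.Boundaryless] {F G : ℝ × M → ℝ}
    (hF : ContMDiff (𝓘(ℝ, ℝ).prod I) 𝓘(ℝ) ∞ F) (hG : ContMDiff (𝓘(ℝ, ℝ).prod I) 𝓘(ℝ) ∞ G)
    {t₀ : ℝ} {F' G' : M → ℝ} (hF' : ContMDiff I 𝓘(ℝ) ∞ F') (hG' : ContMDiff I 𝓘(ℝ) ∞ G')
    (hFd : ∀ p, HasDerivAt (fun t ↦ F (t, p)) (F' p) t₀)
    (hGd : ∀ p, HasDerivAt (fun t ↦ G (t, p)) (G' p) t₀) (q : M) :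
    HasDerivAt (fun t ↦ P.bracket (fun p ↦ F (t, p)) (fun p ↦ G (t, p)) q)
      (P.bracket F' (fun p ↦ G (t₀, p)) q + P.bracket (fun p ↦ F (t₀, p)) G' q) t₀ := by
  let S : (E →L[ℝ] ℝ) →L[ℝ] E := P.sharp q
  let α : ℝ → E →L[ℝ] ℝ := fun t ↦ mvfderiv I (fun p ↦ F (t, p)) q
  let β : ℝ → E →L[ℝ] ℝ := fun t ↦ mvfderiv I (fun p ↦ G (t, p)) q
  have hα : HasDerivAt α (mvfderiv I F' q : E →L[ℝ] ℝ) t₀ :=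
    hasDerivAt_mvfderiv_family hF hF' hFd q
  have hβ : HasDerivAt β (mvfderiv I G' q : E →L[ℝ] ℝ) t₀ :=
    hasDerivAt_mvfderiv_family hG hG' hGd q
  have h := hβ.clm_apply (S.hasFDerivAt.comp_hasDerivAt t₀ hα)
  exact h.congr_deriv (add_comm _ _)

end PoissonStructure

end Bracket

/-! ### Invariance of the bracket under Hamiltonian flows -/

section VariableTime

variable {E : Type*} [NormedAddCommGroup E] [NormedSpace ℝ E]
  {H : Type*} [TopologicalSpace H] {I : ModelWithCorners ℝ E H}
  {M : Type*} [TopologicalSpace M] [ChartedSpace H M]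

/-- Derivative of a function along an integral curve. -/
theorem IsMIntegralCurve.hasDerivAt_comp {X : ∀ p : M, TangentSpace I p} {γ : ℝ → M}
    (hγ : IsMIntegralCurve γ X) {a : M → ℝ} (ha : ContMDiff I 𝓘(ℝ) ∞ a) (t : ℝ) :
    HasDerivAt (fun t ↦ a (γ t)) (mvfderiv I a (γ t) (X (γ t))) t := by
  have h := ((ha.mdifferentiable (by simp) (γ t)).hasMFDerivAt.comp t (hγ t))
  have h' : HasMFDerivAt 𝓘(ℝ, ℝ) 𝓘(ℝ, ℝ) (a ∘ γ) t
      (ContinuousLinearMap.toSpanSingleton ℝ (mvfderiv I a (γ t) (X (γ t)))) := by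
    refine h.congr_mfderiv ?_
    ext
    change mfderiv I 𝓘(ℝ) a (γ t) ((1 : ℝ) • X (γ t)) = (1 : ℝ) • mfderiv I 𝓘(ℝ) a (γ t) (X (γ t))
    rw [one_smul, one_smul]
  exact h'.hasFDerivAt

/-- Chain rule for a family `F` of functions evaluated at a time depending on the point. -/
theorem mvfderiv_family_comp {F : ℝ × M → ℝ} (hF : ContMDiff (𝓘(ℝ, ℝ).prod I) 𝓘(ℝ) ∞ F)
    {s : M → ℝ} (hs : ContMDiff I 𝓘(ℝ) ∞ s) (p : M) {c : ℝ}
    (hc : HasDerivAt (fun t ↦ F (t, p)) c (s p)) :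
    mvfderiv I (fun q ↦ F (s q, q)) p =
      mvfderiv I (fun q ↦ F (s p, q)) p + c • mvfderiv I s p := by
  have hsd := hs.mdifferentiable (by simp) p
  have hFd := hF.mdifferentiable (by simp) (s p, p)
  have hpair : mfderiv I (𝓘(ℝ, ℝ).prod I) (fun q ↦ (s q, q)) p =
      (mfderiv I 𝓘(ℝ) s p).prod (mfderiv I I id p) := mfderiv_prodMk hsd mdifferentiableAt_id
  ext v
  have h1 : mvfderiv I (fun q ↦ F (s q, q)) p v =
      mfderiv (𝓘(ℝ, ℝ).prod I) 𝓘(ℝ) F (s p, p)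
        (mfderiv I (𝓘(ℝ, ℝ).prod I) (fun q ↦ (s q, q)) p v) :=
    mvfderiv_comp_apply p (g := F) (f := fun q ↦ (s q, q)) hFd
      (hsd.prodMk mdifferentiableAt_id) v
  have h2 : ∀ u : TangentSpace (𝓘(ℝ, ℝ).prod I) (s p, p),
      mfderiv (𝓘(ℝ, ℝ).prod I) 𝓘(ℝ) F (s p, p) u =
      mfderiv 𝓘(ℝ, ℝ) 𝓘(ℝ) (fun t ↦ F (t, p)) (s p) u.1 +
        mfderiv I 𝓘(ℝ) (fun q ↦ F (s p, q)) p u.2 := fun u ↦ mfderiv_prod_eq_add_apply hFd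
  rw [h1, h2, hpair, mfderiv_id, hc.hasFDerivAt.hasMFDerivAt.mfderiv, add_comm]
  exact (fun x w : ℝ ↦ (by ring : x + w * c = x + c * w))
    (mfderiv I 𝓘(ℝ) (fun q ↦ F (s p, q)) p v) (mfderiv I 𝓘(ℝ) s p v)

end VariableTime

section FlowInvariance

variable {E : Type*} [NormedAddCommGroup E] [NormedSpace ℝ E] [FiniteDimensional ℝ E]
  {H : Type*} [TopologicalSpace H] {I : ModelWithCorners ℝ E H} [I.Boundaryless]
  {M : Type*} [TopologicalSpace M] [ChartedSpace H M] [IsManifold I ∞ M] [T2Space M]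
  (P : PoissonStructure I M) {h : M → ℝ}

namespace PoissonStructure

omit [FiniteDimensional ℝ E] [I.Boundaryless] [T2Space M] in
theorem hasDerivAt_comp_hamiltonianFlow (hc : IsCompleteField I (P.hamiltonianField h))
    {a : M → ℝ} (ha : ContMDiff I 𝓘(ℝ) ∞ a) (p : M) (t : ℝ) :
    HasDerivAt (fun t ↦ a (fieldFlow I (P.hamiltonianField h) t p))
      (P.bracket h a (fieldFlow I (P.hamiltonianField h) t p)) t :=
  (hc.isMIntegralCurve_fieldFlow p).hasDerivAt_comp ha t

theorem contMDiff_comp_hamiltonianFlow (hh : ContMDiff I 𝓘(ℝ) ∞ h)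
    (hc : IsCompleteField I (P.hamiltonianField h)) {a : M → ℝ} (ha : ContMDiff I 𝓘(ℝ) ∞ a) :
    ContMDiff (𝓘(ℝ, ℝ).prod I) 𝓘(ℝ) ∞
      fun z : ℝ × M ↦ a (fieldFlow I (P.hamiltonianField h) z.1 z.2) :=
  ha.comp (hc.contMDiff_fieldFlow (P.contMDiff_hamiltonianField hh))

/-- Infinitesimal form of the invariance of the bracket under the flow of `h`: the Jacobi
identity. -/
theorem hasDerivAt_bracket_comp_flow_zero (hh : ContMDiff I 𝓘(ℝ) ∞ h)
    (hc : IsCompleteField I (P.hamiltonianField h)) {a b : M → ℝ} (ha : ContMDiff I 𝓘(ℝ) ∞ a)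
    (hb : ContMDiff I 𝓘(ℝ) ∞ b) (p : M) :
    HasDerivAt (fun t ↦ P.bracket (fun q ↦ a (fieldFlow I (P.hamiltonianField h) t q))
      (fun q ↦ b (fieldFlow I (P.hamiltonianField h) t q))
      (fieldFlow I (P.hamiltonianField h) (-t) p)) 0 0 := by
  set ψ := fieldFlow I (P.hamiltonianField h) with hψ
  have hψ0 : ∀ q, ψ 0 q = q := hc.fieldFlow_zero
  have hA := P.contMDiff_comp_hamiltonianFlow hh hc ha
  have hB := P.contMDiff_comp_hamiltonianFlow hh hc hb
  have hAd : ∀ q, HasDerivAt (fun t ↦ a (ψ t q)) (P.bracket h a q) 0 := fun q ↦ by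
    simpa [← hψ, hψ0] using P.hasDerivAt_comp_hamiltonianFlow hc ha q 0
  have hBd : ∀ q, HasDerivAt (fun t ↦ b (ψ t q)) (P.bracket h b q) 0 := fun q ↦ by
    simpa [← hψ, hψ0] using P.hasDerivAt_comp_hamiltonianFlow hc hb q 0
  -- the two occurrences of the time are separated
  let L : ℝ × ℝ → ℝ := fun z ↦ P.bracket (fun q ↦ a (ψ z.1 q)) (fun q ↦ b (ψ z.1 q)) (ψ (-z.2) p)
  have hL : ContDiff ℝ ∞ L := by
    have h1 : ContMDiff 𝓘(ℝ, ℝ × ℝ) I ∞ fun z : ℝ × ℝ ↦ ψ (-z.2) p :=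
      (hc.contMDiff_fieldFlow (P.contMDiff_hamiltonianField hh)).comp
        (f := fun z : ℝ × ℝ ↦ (-z.2, p)) (contDiff_snd.neg.contMDiff.prodMk contMDiff_const)
    exact ((P.contMDiff_bracket_family hA hB).comp
      (f := fun z : ℝ × ℝ ↦ (z.1, ψ (-z.2) p)) (contDiff_fst.contMDiff.prodMk h1)).contDiff
  have hLd : HasFDerivAt L (fderiv ℝ L (0, 0)) (0, 0) :=
    (hL.differentiable (by simp) (0, 0)).hasFDerivAt
  have h1 : HasDerivAt (fun t ↦ L (t, 0)) (fderiv ℝ L (0, 0) (1, 0)) 0 :=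
    HasFDerivAt.comp_hasDerivAt (f := fun t : ℝ ↦ (t, (0 : ℝ))) 0 hLd
      ((hasDerivAt_id (0 : ℝ)).prodMk (hasDerivAt_const (0 : ℝ) (0 : ℝ)))
  have h2 : HasDerivAt (fun t ↦ L (0, t)) (fderiv ℝ L (0, 0) (0, 1)) 0 :=
    HasFDerivAt.comp_hasDerivAt (f := fun t : ℝ ↦ ((0 : ℝ), t)) 0 hLd
      ((hasDerivAt_const (0 : ℝ) (0 : ℝ)).prodMk (hasDerivAt_id (0 : ℝ)))
  have h3 : HasDerivAt (fun t ↦ L (t, t)) (fderiv ℝ L (0, 0) (1, 1)) 0 :=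
    HasFDerivAt.comp_hasDerivAt (f := fun t : ℝ ↦ (t, t)) 0 hLd
      ((hasDerivAt_id (0 : ℝ)).prodMk (hasDerivAt_id (0 : ℝ)))
  have h1' : HasDerivAt (fun t ↦ L (t, 0))
      (P.bracket (P.bracket h a) b p + P.bracket a (P.bracket h b) p) 0 := by
    have := P.hasDerivAt_bracket_family hA hB (P.contMDiff_bracket hh ha)
      (P.contMDiff_bracket hh hb) hAd hBd p
    simpa [L, ← hψ, hψ0] using this
  have h2' : HasDerivAt (fun t ↦ L (0, t)) (-P.bracket h (P.bracket a b) p) 0 := by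
    have := (P.hasDerivAt_comp_hamiltonianFlow hc (P.contMDiff_bracket ha hb) p (-0)).comp
      (0 : ℝ) (hasDerivAt_neg (0 : ℝ))
    refine (this.congr_deriv (by simp [← hψ, hψ0])).congr_of_eventuallyEq (.of_forall fun t ↦ ?_)
    simp [L, ← hψ, hψ0]
  refine h3.congr_deriv ?_
  have hsum : fderiv ℝ L (0, 0) (1, 1) =
      fderiv ℝ L (0, 0) (1, 0) + fderiv ℝ L (0, 0) (0, 1) := by
    rw [← map_add]; simp
  rw [hsum, h1.unique h1', h2.unique h2', P.jacobi_leibniz ha hb hh p]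
  ring

/-- The flow of a Hamiltonian field preserves the bracket. -/
theorem bracket_comp_hamiltonianFlow (hh : ContMDiff I 𝓘(ℝ) ∞ h)
    (hc : IsCompleteField I (P.hamiltonianField h)) {a b : M → ℝ} (ha : ContMDiff I 𝓘(ℝ) ∞ a)
    (hb : ContMDiff I 𝓘(ℝ) ∞ b) (t : ℝ) (p : M) :
    P.bracket (fun q ↦ a (fieldFlow I (P.hamiltonianField h) t q))
      (fun q ↦ b (fieldFlow I (P.hamiltonianField h) t q)) p =
      P.bracket a b (fieldFlow I (P.hamiltonianField h) t p) := by
  have hadd := hc.fieldFlow_add (P.contMDiff_hamiltonianField hh)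
  have hsm := fun {a : M → ℝ} (ha : ContMDiff I 𝓘(ℝ) ∞ a) (t : ℝ) ↦
    contMDiff_slice (P.contMDiff_comp_hamiltonianFlow hh hc ha) t
  have h0 := hc.fieldFlow_zero
  set ψ := fieldFlow I (P.hamiltonianField h) with hψ
  -- the group law carries the vanishing of the derivative from time `0` to every time `s`
  let c : ℝ → ℝ := fun s ↦ P.bracket (fun q ↦ a (ψ s q)) (fun q ↦ b (ψ s q)) (ψ (-s) (ψ t p))
  have hcd : ∀ s, HasDerivAt c 0 s := by
    intro s
    have h1 := P.hasDerivAt_bracket_comp_flow_zero hh hc (hsm ha s) (hsm hb s) (ψ (-s) (ψ t p))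
    simp only [← hψ, ← hadd] at h1
    have h2 : HasDerivAt (fun r ↦ c (s + r)) 0 0 := by
      refine h1.congr_of_eventuallyEq (.of_forall fun r ↦ ?_)
      simp only [c, ← hadd]
      rw [show -r + (-s + t) = -(s + r) + t by ring]
    have h3 : HasDerivAt (fun r ↦ c (s + r)) 0 (-s + s) := by simpa using h2
    have := h3.comp_const_add (-s) s
    simpa using this
  have hconst := is_const_of_deriv_eq_zero (fun s ↦ (hcd s).differentiableAt)
    (fun s ↦ (hcd s).deriv) t 0
  simpa [c, h0, ← hadd] using hconst

end PoissonStructure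

end FlowInvariance

/-! ### Integrals of smooth families of functions -/

section ParametricIntegral

variable {E : Type*} [NormedAddCommGroup E] [NormedSpace ℝ E] [FiniteDimensional ℝ E]

/-- Differentiation under the integral sign for a `C¹` integrand on a compact interval. -/
theorem hasFDerivAt_intervalIntegral_of_contDiff {G : ℝ × E → ℝ} (hG : ContDiff ℝ 1 G)
    (a b : ℝ) (y₀ : E) :
    HasFDerivAt (fun y ↦ ∫ t in a..b, G (t, y))
      (∫ t in a..b, fderiv ℝ G (t, y₀) ∘L .inr ℝ ℝ E) y₀ := by
  have := FiniteDimensional.proper ℝ E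
  have hcont : Continuous fun z : ℝ × E ↦ fderiv ℝ G z ∘L .inr ℝ ℝ E :=
    (hG.continuous_fderiv (by simp)).clm_comp continuous_const
  have hG1 : ∀ y, Continuous fun t ↦ G (t, y) := fun y ↦ hG.continuous.comp (by fun_prop)
  have hG2 : ∀ y, Continuous fun t ↦ fderiv ℝ G (t, y) ∘L .inr ℝ ℝ E :=
    fun y ↦ hcont.comp (f := fun t : ℝ ↦ (t, y)) (by fun_prop)
  obtain ⟨C, hC⟩ := (isCompact_uIcc.prod (isCompact_closedBall y₀ 1)).exists_bound_of_continuousOn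
    (s := Set.uIcc a b ×ˢ Metric.closedBall y₀ 1) hcont.continuousOn
  refine (intervalIntegral.hasFDerivAt_integral_of_dominated_of_fderiv_le
    (F := fun y t ↦ G (t, y)) (F' := fun y t ↦ fderiv ℝ G (t, y) ∘L .inr ℝ ℝ E)
    (bound := fun _ ↦ C) (Metric.ball_mem_nhds y₀ one_pos)
    (.of_forall fun y ↦ (hG1 y).aestronglyMeasurable) ((hG1 y₀).intervalIntegrable _ _)
    (hG2 y₀).aestronglyMeasurable (.of_forall fun t ht y hy ↦ ?_)
    intervalIntegrable_const (.of_forall fun t _ y _ ↦ ?_))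
  · exact hC (t, y) ⟨Set.uIoc_subset_uIcc ht, Metric.ball_subset_closedBall hy⟩
  · exact ((hG.differentiable (by simp) (t, y)).hasFDerivAt).comp y
      (hasFDerivAt_prodMk_right t y)

/-- The integral of a `Cⁿ` function over a compact interval is `Cⁿ` in the parameter. -/
theorem contDiff_intervalIntegral (n : ℕ) {G : ℝ × E → ℝ} (hG : ContDiff ℝ n G) (a b : ℝ) :
    ContDiff ℝ n fun y ↦ ∫ t in a..b, G (t, y) := by
  induction n generalizing G with
  | zero =>
    exact contDiff_zero.2 (intervalIntegral.continuous_parametric_intervalIntegral_of_continuous'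
      (by exact hG.continuous.comp (continuous_snd.prodMk continuous_fst)) a b)
  | succ n ih =>
    push_cast at hG ⊢
    have hG1 : ContDiff ℝ 1 G := hG.of_le (by simp)
    have h := hasFDerivAt_intervalIntegral_of_contDiff hG1 a b
    refine contDiff_succ_iff_fderiv_apply.2 ⟨fun y ↦ (h y).differentiableAt, by simp, fun v ↦ ?_⟩
    have hv : ContDiff ℝ n fun z ↦ fderiv ℝ G z (0, v) :=
      (hG.fderiv_right le_rfl).clm_apply contDiff_const
    convert! ih hv using 2 with y
    rw [(h y).fderiv, ContinuousLinearMap.intervalIntegral_apply]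
    · simp
    · refine Continuous.intervalIntegrable ?_ _ _
      exact ((hG1.continuous_fderiv (by simp)).comp (by fun_prop)).clm_comp continuous_const

variable {H : Type*} [TopologicalSpace H] {I : ModelWithCorners ℝ E H} [I.Boundaryless]
  {M : Type*} [TopologicalSpace M] [ChartedSpace H M] [IsManifold I ∞ M]

/-- A smooth function on `ℝ × M`, read in the chart at `p`, agrees near the slice `ℝ × {p}` with
a smooth function on `ℝ × E`; the neighbourhood of `p` does not depend on the time. -/
theorem exists_contDiff_eq_chart {F : ℝ × M → ℝ}
    (hF : ContMDiff (𝓘(ℝ, ℝ).prod I) 𝓘(ℝ) ∞ F) (p : M) :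
    ∃ G : ℝ × E → ℝ, ContDiff ℝ ∞ G ∧ ∀ᶠ y in 𝓝 (extChartAt I p p), ∀ t,
      G (t, y) = F (t, (extChartAt I p).symm y) := by
  obtain ⟨r, hr, hrU⟩ := Metric.mem_nhds_iff.1 (extChartAt_target_mem_nhds (I := I) p)
  let χ : ContDiffBump (extChartAt I p p) := ⟨r / 4, r / 2, by positivity, by linarith⟩
  refine ⟨fun z ↦ χ z.2 * F (z.1, (extChartAt I p).symm z.2),
    contDiff_iff_contDiffAt.2 fun z ↦ ?_, ?_⟩
  · by_cases he : z.2 ∈ Metric.ball (extChartAt I p p) r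
    · have hsymm : ContMDiffAt 𝓘(ℝ, E) I ∞ (extChartAt I p).symm z.2 :=
        (contMDiffOn_extChartAt_symm p).contMDiffAt
          ((isOpen_extChartAt_target p).mem_nhds (hrU he))
      have h1 : ContMDiffAt 𝓘(ℝ, ℝ × E) (𝓘(ℝ, ℝ).prod I) ∞
          (fun z : ℝ × E ↦ (z.1, (extChartAt I p).symm z.2)) z :=
        contDiffAt_fst.contMDiffAt.prodMk
          (ContMDiffAt.comp z hsymm contDiffAt_snd.contMDiffAt)
      exact (χ.contDiffAt.comp z contDiffAt_snd).mul (hF.contMDiffAt.comp _ h1).contDiffAt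
    · have he' : z.2 ∉ tsupport χ := by
        rw [χ.tsupport_eq]
        intro h
        have h : Dist.dist z.2 (extChartAt I p p) ≤ r / 2 := h
        rw [Metric.mem_ball] at he
        linarith
      refine (contDiffAt_const (c := (0 : ℝ))).congr_of_eventuallyEq ?_
      filter_upwards [continuousAt_snd.eventually (notMem_tsupport_iff_eventuallyEq.1 he')]
        with w hw
      rw [show χ w.2 = 0 from hw, zero_mul]
  · filter_upwards [χ.eventuallyEq_one] with y hy t
    rw [show χ y = 1 from hy, one_mul]

theorem contMDiff_intervalIntegral {F : ℝ × M → ℝ}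
    (hF : ContMDiff (𝓘(ℝ, ℝ).prod I) 𝓘(ℝ) ∞ F) (a b : ℝ) :
    ContMDiff I 𝓘(ℝ) ∞ fun p ↦ ∫ t in a..b, F (t, p) := by
  intro p
  obtain ⟨G, hG, hGF⟩ := exists_contDiff_eq_chart hF p
  have h1 : ContDiff ℝ ∞ fun y ↦ ∫ t in a..b, G (t, y) :=
    contDiff_infty.2 fun n ↦ contDiff_intervalIntegral n (hG.of_le (by exact_mod_cast le_top)) a b
  refine (h1.contMDiff.contMDiffAt.comp p
    (contMDiffAt_extChartAt (I := I))).congr_of_eventuallyEq ?_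
  filter_upwards [(continuousAt_extChartAt p).eventually hGF,
    extChartAt_source_mem_nhds (I := I) p] with q hq hqs
  simp only [Function.comp_apply, hq, (extChartAt I p).left_inv hqs]

theorem mvfderiv_intervalIntegral {F : ℝ × M → ℝ}
    (hF : ContMDiff (𝓘(ℝ, ℝ).prod I) 𝓘(ℝ) ∞ F) (a b : ℝ) (p : M) (v : TangentSpace I p) :
    mvfderiv I (fun p ↦ ∫ t in a..b, F (t, p)) p v =
      ∫ t in a..b, mvfderiv I (fun q ↦ F (t, q)) p v := by
  obtain ⟨G, hG, hGF⟩ := exists_contDiff_eq_chart hF p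
  have hG1 : ContDiff ℝ 1 G := hG.of_le (by simp)
  have key : ∀ {a : M → ℝ} {c : E → ℝ} {c' : E →L[ℝ] ℝ}, ContMDiff I 𝓘(ℝ) ∞ a →
      (∀ᶠ y in 𝓝 (extChartAt I p p), c y = a ((extChartAt I p).symm y)) →
      HasFDerivAt c c' (extChartAt I p p) → (mvfderiv I a p : E →L[ℝ] ℝ) = c' := by
    intro a c c' ha hc hc'
    rw [(ha.mdifferentiable (by simp) p).mvfderiv, I.range_eq_univ, fderivWithin_univ]
    exact (hc'.congr_of_eventuallyEq (hc.mono fun y hy ↦ hy.symm)).fderiv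
  have h1 := key (contMDiff_intervalIntegral hF a b) (hGF.mono fun y hy ↦ by simp only [hy])
    (hasFDerivAt_intervalIntegral_of_contDiff hG1 a b _)
  have h2 := fun t ↦ key (contMDiff_slice hF t) (hGF.mono fun y hy ↦ hy t)
    ((hG1.differentiable (by simp) (t, extChartAt I p p)).hasFDerivAt.comp _
      (hasFDerivAt_prodMk_right t (extChartAt I p p)))
  simp only [h2]
  have hint : IntervalIntegrable
      (fun t ↦ fderiv ℝ G (t, extChartAt I p p) ∘L ContinuousLinearMap.inr ℝ ℝ E)
      MeasureTheory.volume a b :=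
    (((hG1.continuous_fderiv (by simp)).comp (by fun_prop)).clm_comp
      continuous_const).intervalIntegrable _ _
  have h3 : ∀ w : E, (∫ t in a..b, fderiv ℝ G (t, extChartAt I p p) ∘L .inr ℝ ℝ E) w =
      ∫ t in a..b, (fderiv ℝ G (t, extChartAt I p p) ∘L .inr ℝ ℝ E) w :=
    fun w ↦ ContinuousLinearMap.intervalIntegral_apply hint w
  rw [h1]
  exact h3 v

end ParametricIntegral

/-! ### Periodic Hamiltonian flows -/

section PeriodicFlow

variable {E : Type*} [NormedAddCommGroup E] [NormedSpace ℝ E] [FiniteDimensional ℝ E]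
  {H : Type*} [TopologicalSpace H] {I : ModelWithCorners ℝ E H} [I.Boundaryless]
  {M : Type*} [TopologicalSpace M] [ChartedSpace H M] [IsManifold I ∞ M] [T2Space M]
  (P : PoissonStructure I M) {h T : M → ℝ}

/-- Every covector is the differential of a globally defined smooth function. -/
theorem exists_contMDiff_mvfderiv_eq (p : M) (α : E →L[ℝ] ℝ) :
    ∃ a : M → ℝ, ContMDiff I 𝓘(ℝ) ∞ a ∧ (mvfderiv I a p : E →L[ℝ] ℝ) = α := by
  obtain ⟨χ⟩ : Nonempty (SmoothBumpFunction I p) := inferInstance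
  have hg : ContMDiffOn I 𝓘(ℝ) ∞ (fun q ↦ α (extChartAt I p q)) (chartAt H p).source :=
    α.contDiff.contMDiff.comp_contMDiffOn contMDiffOn_extChartAt
  have ha := χ.contMDiff_smul hg
  refine ⟨_, ha, ?_⟩
  rw [(ha.mdifferentiable (by simp) p).mvfderiv, I.range_eq_univ, fderivWithin_univ]
  refine (α.hasFDerivAt.congr_of_eventuallyEq ?_).fderiv
  have hc : ContinuousAt (extChartAt I p).symm (extChartAt I p p) := continuousAt_extChartAt_symm p
  have h1 : ∀ᶠ q in 𝓝 ((extChartAt I p).symm (extChartAt I p p)), χ q = 1 := by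
    rw [extChartAt_to_inv]
    exact χ.eventuallyEq_one
  filter_upwards [hc.eventually h1, extChartAt_target_mem_nhds (I := I) p] with y hy hyt
  change χ ((extChartAt I p).symm y) • α (extChartAt I p ((extChartAt I p).symm y)) = α y
  rw [hy, (extChartAt I p).right_inv hyt, one_smul]

omit [FiniteDimensional ℝ E] [I.Boundaryless] [T2Space M] [IsManifold I ∞ M] in
theorem wedgeVec_smul_right {p : M} (x : TangentSpace I p) (c : ℝ) :
    wedgeVec I x (c • x) = 0 := by
  have h1 : (![x, c • x] : Fin 2 → TangentSpace I p) = Function.update ![x, x] 1 (c • x) := by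
    ext i; fin_cases i <;> simp
  rw [wedgeVec, h1, AlternatingMap.map_update_smul]
  rw [(exteriorPower.ιMulti ℝ 2).map_eq_zero_of_eq _ (i := 0) (j := 1) (by simp) (by simp),
    smul_zero]

namespace PoissonStructure

omit [FiniteDimensional ℝ E] [I.Boundaryless] [T2Space M] in
/-- A function commuting with `h` is constant along the flow of `h`. -/
theorem comp_hamiltonianFlow_eq_self (hc : IsCompleteField I (P.hamiltonianField h))
    {a : M → ℝ} (ha : ContMDiff I 𝓘(ℝ) ∞ a) (h0 : ∀ p, P.bracket h a p = 0) (t : ℝ) (p : M) :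
    a (fieldFlow I (P.hamiltonianField h) t p) = a p := by
  have hd := P.hasDerivAt_comp_hamiltonianFlow hc ha p
  have := is_const_of_deriv_eq_zero (fun s ↦ (hd s).differentiableAt)
    (fun s ↦ by rw [(hd s).deriv, h0]) t 0
  rwa [hc.fieldFlow_zero] at this

/-- The bivector `X_h ∧ X_T` vanishes, tested on `da` and `db`. Differentiating
`a (Fl^{T(q)} q) = a q` at `q = p` gives `da = d(a ∘ Fl^{T(p)}) + {h, a} dT`. As `Fl^{T(p)}`
preserves the bracket and fixes `p`, the contributions of `dT` to `{a, b}` must cancel. -/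
theorem bracket_mul_bracket_period (hh : ContMDiff I 𝓘(ℝ) ∞ h)
    (hT : HasPeriodicFlow I (P.hamiltonianField h) T) {a b : M → ℝ} (ha : ContMDiff I 𝓘(ℝ) ∞ a)
    (hb : ContMDiff I 𝓘(ℝ) ∞ b) (p : M) :
    P.bracket h a p * P.bracket T b p = P.bracket h b p * P.bracket T a p := by
  set ψ := fieldFlow I (P.hamiltonianField h) with hψ
  have hper : ∀ q, ψ (T q) q = q := fun q ↦ by
    simpa [← hψ, hT.complete.fieldFlow_zero] using hT.periodic q 0
  have hpull : ∀ {a : M → ℝ}, ContMDiff I 𝓘(ℝ) ∞ a → mvfderiv I a p =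
      mvfderiv I (fun q ↦ a (ψ (T p) q)) p + P.bracket h a p • mvfderiv I T p := by
    intro a ha
    have hd := P.hasDerivAt_comp_hamiltonianFlow hT.complete ha p (T p)
    rw [← hψ, hper] at hd
    have := mvfderiv_family_comp (P.contMDiff_comp_hamiltonianFlow hh hT.complete ha)
      hT.smooth p hd
    simpa only [← hψ, hper] using this
  have hinv := P.bracket_comp_hamiltonianFlow hh hT.complete ha hb (T p) p
  rw [← hψ, hper] at hinv
  have hTT : mvfderiv I T p (P.sharp p (mvfderiv I T p)) = 0 := P.bracket_self T p
  have hskew := P.skew p (mvfderiv I T p) (mvfderiv I (fun q ↦ a (ψ (T p) q)) p)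
  have hab : P.bracket a b p = mvfderiv I b p (P.sharp p (mvfderiv I a p)) := rfl
  have hTa : P.bracket T a p = mvfderiv I a p (P.sharp p (mvfderiv I T p)) := rfl
  have hTb : P.bracket T b p = mvfderiv I b p (P.sharp p (mvfderiv I T p)) := rfl
  have hpb : P.bracket (fun q ↦ a (ψ (T p) q)) (fun q ↦ b (ψ (T p) q)) p =
    mvfderiv I (fun q ↦ b (ψ (T p) q)) p (P.sharp p (mvfderiv I (fun q ↦ a (ψ (T p) q)) p)) := rfl
  rw [hpull ha, hpull hb] at hab
  rw [hpull ha] at hTa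
  rw [hpull hb] at hTb
  simp only [map_add, map_smul, add_apply, smul_apply,
    smul_eq_mul, hTT] at hab hTa hTb
  rw [hTa, hTb]
  linear_combination -hab + hpb - hinv - P.bracket h b p * hskew

/-- The period is constant along the flow: take `a = T` and `b = h` in the period relation. -/
theorem bracket_period_eq_zero (hh : ContMDiff I 𝓘(ℝ) ∞ h)
    (hT : HasPeriodicFlow I (P.hamiltonianField h) T) (p : M) : P.bracket h T p = 0 := by
  have h1 := P.bracket_mul_bracket_period hh hT hT.smooth hh p
  rw [P.bracket_self T, mul_zero, P.bracket_skew T h] at h1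
  have h2 : P.bracket h T p ^ 2 = 0 := by linarith
  simpa using h2

theorem bracket_mul_bracket_period_of_invariant (hh : ContMDiff I 𝓘(ℝ) ∞ h)
    (hT : HasPeriodicFlow I (P.hamiltonianField h) T) {a g : M → ℝ} (ha : ContMDiff I 𝓘(ℝ) ∞ a)
    (hg : ContMDiff I 𝓘(ℝ) ∞ g) (h0 : ∀ p, P.bracket h g p = 0) (p : M) :
    P.bracket h a p * P.bracket T g p = 0 := by
  rw [P.bracket_mul_bracket_period hh hT ha hg p, h0, zero_mul]

/-- The Hamiltonian field of the period is proportional to a nonzero `X_h`. -/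
theorem exists_hamiltonianField_period_eq_smul (hh : ContMDiff I 𝓘(ℝ) ∞ h)
    (hT : HasPeriodicFlow I (P.hamiltonianField h) T) (p : M)
    (hp : P.hamiltonianField h p ≠ 0) :
    ∃ c : ℝ, P.hamiltonianField T p = c • P.hamiltonianField h p := by
  -- two vectors with `x ∧ y = 0`, tested on covectors
  have key : ∀ x y : E, x ≠ 0 → (∀ α β : E →L[ℝ] ℝ, α x * β y = β x * α y) →
      ∃ c : ℝ, y = c • x := by
    intro x y hx hxy
    obtain ⟨α, hα⟩ := SeparatingDual.exists_ne_zero (R := ℝ) hx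
    refine ⟨α y / α x, ?_⟩
    rw [← sub_eq_zero]
    by_contra hne
    obtain ⟨β, hβ⟩ := SeparatingDual.exists_ne_zero (R := ℝ) hne
    refine hβ ?_
    rw [map_sub, map_smul, smul_eq_mul, sub_eq_zero, div_mul_eq_mul_div, eq_div_iff hα]
    linarith [hxy α β]
  refine key _ _ hp fun α β ↦ ?_
  obtain ⟨a, ha, rfl⟩ := exists_contMDiff_mvfderiv_eq (I := I) p α
  obtain ⟨b, hb, rfl⟩ := exists_contMDiff_mvfderiv_eq (I := I) p β
  exact P.bracket_mul_bracket_period hh hT ha hb p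

omit [FiniteDimensional ℝ E] [I.Boundaryless] [T2Space M] in
theorem hamiltonianField_frequency (hT : ContMDiff I 𝓘(ℝ) ∞ T) (hpos : ∀ p, 0 < T p) (p : M) :
    P.hamiltonianField (frequency T) p =
      -(frequency T p / T p) • P.hamiltonianField T p := by
  have hω : ContMDiff I 𝓘(ℝ) ∞ (frequency T) :=
    contMDiff_const.div₀ hT fun p ↦ (hpos p).ne'
  -- differentiate the constant product `ω T = 2π`
  have h1 : frequency T * T = fun _ ↦ 2 * Real.pi :=
    funext fun q ↦ div_mul_cancel₀ _ (hpos q).ne'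
  have h2 := mvfderiv_mul (hω.mdifferentiable (by simp) p) (hT.mdifferentiable (by simp) p)
  rw [h1, mvfderiv_const] at h2
  have h3 : mvfderiv I (frequency T) p = -(frequency T p / T p) • mvfderiv I T p := by
    have h4 : T p • mvfderiv I (frequency T) p = -(frequency T p) • mvfderiv I T p := by
      rw [neg_smul, eq_neg_iff_add_eq_zero, add_comm]
      exact h2.symm
    rw [← inv_smul_smul₀ (hpos p).ne' (mvfderiv I (frequency T) p), h4, smul_smul]
    congr 1
    ring
  rw [hamiltonianField, h3, map_smul]
  rfl

theorem wedgeVec_hamiltonianField_frequency (hh : ContMDiff I 𝓘(ℝ) ∞ h)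
    (hT : HasPeriodicFlow I (P.hamiltonianField h) T) (p : M) :
    wedgeVec I (P.hamiltonianField h p) (P.hamiltonianField (frequency T) p) = 0 := by
  by_cases hp : P.hamiltonianField h p = 0
  · rw [hp, wedgeVec]
    exact (exteriorPower.ιMulti ℝ 2).map_coord_zero 0 rfl
  · obtain ⟨c, hc⟩ := P.exists_hamiltonianField_period_eq_smul hh hT p hp
    rw [P.hamiltonianField_frequency hT.smooth hT.pos, hc, smul_smul]
    exact wedgeVec_smul_right _ _

/-- The flow of the circle generator is the Hamiltonian flow with time rescaled by the period, which
is constant along the orbits. -/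
theorem fieldFlow_circleGenerator (hh : ContMDiff I 𝓘(ℝ) ∞ h)
    (hT : HasPeriodicFlow I (P.hamiltonianField h) T) (t : ℝ) (p : M) :
    fieldFlow I (circleGenerator I (P.hamiltonianField h) (frequency T)) t p =
      fieldFlow I (P.hamiltonianField h) (t / (2 * Real.pi) * T p) p := by
  have hω : ∀ q, (frequency T q)⁻¹ = T q / (2 * Real.pi) := fun q ↦ inv_div _ _
  have hY : ContMDiff I I.tangent ∞ fun p ↦
      (⟨p, circleGenerator I (P.hamiltonianField h) (frequency T) p⟩ : TangentBundle I M) := by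
    refine ContMDiff.smul_section ?_ (P.contMDiff_hamiltonianField hh)
    simp only [hω]
    exact hT.smooth.div_const _
  have hTψ := P.comp_hamiltonianFlow_eq_self hT.complete hT.smooth
    (P.bracket_period_eq_zero hh hT)
  have h1 := (hT.complete.isMIntegralCurve_fieldFlow p).comp_mul (T p / (2 * Real.pi))
  have h2 : IsMIntegralCurve (fun s ↦ fieldFlow I (P.hamiltonianField h)
      (s * (T p / (2 * Real.pi))) p)
      (circleGenerator I (P.hamiltonianField h) (frequency T)) := by
    intro s
    have h3 := h1 s
    refine h3.congr_mfderiv ?_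
    simp only [circleGenerator, hω, hTψ, Function.comp_apply, Pi.smul_apply]
    rfl
  have h3 := fieldFlow_eq_of_isMIntegralCurve hY h2 t
  simp only [zero_mul, hT.complete.fieldFlow_zero] at h3
  rw [h3]
  congr 1
  ring

/-- For an invariant `g` the bracket `{·, g}` commutes with pullback by the circle action, that is,
by the Hamiltonian flow for a time proportional to the period. The variable time contributes a
multiple of `{h, f} {T, g}`, which vanishes. -/
theorem bracket_comp_circleFlow (hh : ContMDiff I 𝓘(ℝ) ∞ h)
    (hT : HasPeriodicFlow I (P.hamiltonianField h) T) {f g : M → ℝ} (hf : ContMDiff I 𝓘(ℝ) ∞ f)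
    (hg : ContMDiff I 𝓘(ℝ) ∞ g) (h0 : ∀ p, P.bracket h g p = 0) (c : ℝ) (p : M) :
    P.bracket (fun q ↦ f (fieldFlow I (P.hamiltonianField h) (c * T q) q)) g p =
      P.bracket f g (fieldFlow I (P.hamiltonianField h) (c * T p) p) := by
  have hg' := P.comp_hamiltonianFlow_eq_self hT.complete hg h0 (c * T p)
  have hT' := P.comp_hamiltonianFlow_eq_self hT.complete hT.smooth
    (P.bracket_period_eq_zero hh hT) (c * T p)
  have hinv := P.bracket_comp_hamiltonianFlow hh hT.complete hf hg (c * T p) p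
  have hTinv := P.bracket_comp_hamiltonianFlow hh hT.complete hT.smooth hg (c * T p) p
  have hF := P.contMDiff_comp_hamiltonianFlow hh hT.complete hf
  have hd := P.hasDerivAt_comp_hamiltonianFlow hT.complete hf p (c * T p)
  set ψ := fieldFlow I (P.hamiltonianField h) with hψ
  simp only [hg'] at hinv
  simp only [hg', hT'] at hTinv
  have hF' : ContMDiff (𝓘(ℝ, ℝ).prod I) 𝓘(ℝ) ∞ fun z : ℝ × M ↦ f (ψ (c * z.1) z.2) :=
    hF.comp (f := fun z : ℝ × M ↦ (c * z.1, z.2))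
      ((contMDiff_const.mul contMDiff_fst).prodMk contMDiff_snd)
  have hd' : HasDerivAt (fun t ↦ f (ψ (c * t) p)) (P.bracket h f (ψ (c * T p) p) * c) (T p) :=
    hd.comp (T p) (by simpa using (hasDerivAt_id (T p)).const_mul c)
  have h1 := mvfderiv_family_comp hF' hT.smooth p hd'
  have h2 : P.bracket (fun q ↦ f (ψ (c * T q) q)) g p =
      P.bracket (fun q ↦ f (ψ (c * T p) q)) g p +
        P.bracket h f (ψ (c * T p) p) * c * P.bracket T g p := by
    simp only [bracket, bivectorBracket] at h1 ⊢
    rw [h1]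
    simp only [map_add, map_smul, smul_eq_mul]
  have h3 := P.bracket_mul_bracket_period_of_invariant hh hT hf hg h0 (ψ (c * T p) p)
  rw [← hTinv] at h3
  rw [h2, ← hinv]
  linear_combination c * h3

end PoissonStructure

end PeriodicFlow

theorem mainTheorem2
    {E : Type*} [NormedAddCommGroup E] [NormedSpace ℝ E] [FiniteDimensional ℝ E]
    {H : Type*} [TopologicalSpace H] (I : ModelWithCorners ℝ E H) [I.Boundaryless]
    {M : Type*} [TopologicalSpace M] [ChartedSpace H M] [IsManifold I ∞ M] [T2Space M]
    (P : PoissonStructure I M)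
    (h : M → ℝ) (hh : ContMDiff I 𝓘(ℝ) ∞ h)
    (T : M → ℝ) (hT : HasPeriodicFlow I (P.hamiltonianField h) T)
    (f g : M → ℝ) (hf : ContMDiff I 𝓘(ℝ) ∞ f) (hg : ContMDiff I 𝓘(ℝ) ∞ g)
    (hginv : IsInvariantAlong I
      (circleGenerator I (P.hamiltonianField h) (frequency T)) g) :
    (∀ p : M, wedgeVec I (P.hamiltonianField h p) (P.hamiltonianField (frequency T) p) = 0) ∧
    (∀ p : M, P.bracket h g p = 0) ∧
    (ContMDiff I 𝓘(ℝ) ∞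
        (flowAverage I (circleGenerator I (P.hamiltonianField h) (frequency T)) f) ∧
      ∀ p : M,
        flowAverage I (circleGenerator I (P.hamiltonianField h) (frequency T)) (P.bracket f g) p =
          P.bracket (flowAverage I (circleGenerator I (P.hamiltonianField h) (frequency T)) f)
            g p) := by
  have h0 : ∀ p, P.bracket h g p = 0 := by
    intro p
    have hω : (frequency T p)⁻¹ ≠ 0 :=
      inv_ne_zero (div_ne_zero (by positivity) (hT.pos p).ne')
    have h1 := hginv p
    rw [circleGenerator, map_smul, smul_eq_mul] at h1
    exact (mul_eq_zero.1 h1).resolve_left hω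
  -- `F (t, p)` is `f` at the image of `p` under the circle action at time `t`
  let F : ℝ × M → ℝ := fun z ↦
    f (fieldFlow I (P.hamiltonianField h) (z.1 / (2 * Real.pi) * T z.2) z.2)
  have hF : ContMDiff (𝓘(ℝ, ℝ).prod I) 𝓘(ℝ) ∞ F :=
    (P.contMDiff_comp_hamiltonianFlow hh hT.complete hf).comp
      (f := fun z : ℝ × M ↦ (z.1 / (2 * Real.pi) * T z.2, z.2))
      (((contMDiff_fst.div_const _).mul (hT.smooth.comp contMDiff_snd)).prodMk contMDiff_snd)
  have havg : flowAverage I (circleGenerator I (P.hamiltonianField h) (frequency T)) f =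
      fun p ↦ (2 * Real.pi)⁻¹ * ∫ t in (0 : ℝ)..(2 * Real.pi), F (t, p) := by
    ext p
    simp only [flowAverage, P.fieldFlow_circleGenerator hh hT, F]
  have hint := contMDiff_intervalIntegral hF 0 (2 * Real.pi)
  refine ⟨P.wedgeVec_hamiltonianField_frequency hh hT, h0, ?_, fun p ↦ ?_⟩
  · rw [havg]
    exact contMDiff_const.mul hint
  · have h1 : ∀ t, P.bracket f g
        (fieldFlow I (circleGenerator I (P.hamiltonianField h) (frequency T)) t p) =
        -mvfderiv I (fun q ↦ F (t, q)) p (P.hamiltonianField g p) := by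
      intro t
      rw [P.fieldFlow_circleGenerator hh hT, ← P.bracket_comp_circleFlow hh hT hf hg h0,
        P.bracket_skew]
      rfl
    have h2 : mvfderiv I (fun q ↦ (2 * Real.pi)⁻¹ * ∫ t in (0 : ℝ)..(2 * Real.pi), F (t, q)) p =
        (2 * Real.pi)⁻¹ • mvfderiv I (fun q ↦ ∫ t in (0 : ℝ)..(2 * Real.pi), F (t, q)) p := by
      rw [mvfderiv_fun_mul (contMDiff_const.mdifferentiable (n := ∞) (by simp) p)
        (hint.mdifferentiable (by simp) p), mvfderiv_const, smul_zero, add_zero]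
    rw [P.bracket_skew, havg, P.bracket_eq, h2, smul_apply,
      mvfderiv_intervalIntegral hF, flowAverage]
    simp only [h1, intervalIntegral.integral_neg, smul_eq_mul, mul_neg]
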